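/- A topos here is an elementary topos: a category that has finite limits, is cartesian closed, and has a subobject classifier. Let $\mathcal{A}$ and $\mathcal{X}$ be topoi and let $L \colon \mathcal{A} \rightleftarrows \mathcal{X} \colon R$ be any adjunction between them, with $L$ left adjoint to $R$. Let ${}_L\mathsf{StrCsp}$ be the category defined as follows. Its objects are the $L$-structured cospans, that is, the cospans $La \to x \leftarrow Lb$ in $\mathcal{X}$, where $a, b$ are objects of $\mathcal{A}$ and $x$ is an object of $\mathcal{X}$. A morphism from $La \to x \leftarrow Lb$ to $Lc \to y \leftarrow Ld$ is a triple $(f,g,h)$ of arrows $f \colon a \to c$ in $\mathcal{A}$, $g \colon x \to y$ in $\mathcal{X}$ and $h \colon b \to d$ in $\mathcal{A}$ such that the two squares \[ (La \to x \xrightarrow{g} y) = (La \xrightarrow{Lf} Lc \to y), \qquad (Lb \to x \xrightarrow{g} y) = (Lb \xrightarrow{Lh} Ld \to y) \] commute; identities and composition are componentwise. Then ${}_L\mathsf{StrCsp}$ is a topos. -/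

import Mathlib

open CategoryTheory Category Limits

universe v v₁ v₂ u u₁ u₂

/-- A category is a topos (in the elementary sense) if it has finite limits, is cartesian closed,
and has a subobject classifier. Cartesian closedness is expressed by the existence of a choice of
finite products for which every functor `t × -` has a right adjoint. -/
class IsTopos (T : Type u) [Category.{v} T] : Prop where
  hasFiniteLimits : HasFiniteLimits T
  cartesianClosed : ∃ _ : CartesianMonoidalCategory T, Nonempty (MonoidalClosed T)
  hasSubobjectClassifier : HasSubobjectClassifier T

section StrCsp

variable {A : Type u₁} [Category.{v₁} A] {X : Type u₂} [Category.{v₂} X]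

/-- An `L`-structured cospan `L a ⟶ x ⟵ L b`, where `a` is `inputs`, `x` is `apex` and
`b` is `outputs`. -/
structure StrCsp (L : A ⥤ X) where
  inputs : A
  apex : X
  outputs : A
  inl : L.obj inputs ⟶ apex
  inr : L.obj outputs ⟶ apex

namespace StrCsp

variable {L : A ⥤ X}

/-- A morphism from `L a ⟶ x ⟵ L b` to `L c ⟶ y ⟵ L d` is a triple `f : a ⟶ c`, `g : x ⟶ y`,
`h : b ⟶ d` such that `L f`, `g`, `L h` make both squares commute. -/
@[ext]
structure Hom (S S' : StrCsp L) where
  f : S.inputs ⟶ S'.inputs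
  g : S.apex ⟶ S'.apex
  h : S.outputs ⟶ S'.outputs
  wl : S.inl ≫ g = L.map f ≫ S'.inl
  wr : S.inr ≫ g = L.map h ≫ S'.inr

/-- The category of `L`-structured cospans and their morphisms, composed componentwise. -/
instance : Category (StrCsp L) where
  Hom := Hom
  id S :=
    { f := 𝟙 S.inputs
      g := 𝟙 S.apex
      h := 𝟙 S.outputs
      wl := by simp
      wr := by simp }
  comp φ ψ :=
    { f := φ.f ≫ ψ.f
      g := φ.g ≫ ψ.g
      h := φ.h ≫ ψ.h
      wl := by rw [← Category.assoc, φ.wl, Category.assoc, ψ.wl, Functor.map_comp, Category.assoc]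
      wr := by rw [← Category.assoc, φ.wr, Category.assoc, ψ.wr, Functor.map_comp, Category.assoc] }
  id_comp _ := by ext <;> simp
  comp_id _ := by ext <;> simp
  assoc _ _ _ := by ext <;> simp

end StrCsp

end StrCsp

/-! Transposing both legs along `adj` turns an `L`-structured cospan into a pair `a ⟶ R x`, `b ⟶ R
x`. So `StrCsp L` is an iterated Artin gluing: of `A` and `X` along `R`, then of `A` and the result
along `snd ⋙ R`. Both functors are left exact, and gluing topoi along a left exact `G : D ⥤ C` gives
a topos (`IsTopos.comma`).

In `Comma (𝟭 C) G` finite limits are componentwise. The exponential of `b ⟶ G y` by `a ⟶ G x` is `y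
^ x` on the right and the pullback of `b ^ a` and `G (y ^ x)` over `(G y) ^ a` on the left. A
subobject is one on the right together with one on the left lying over its image under `G`; hence
the left truth values are pairs `(p, q)` in `Ω × G Ω` with `p` below `comparison q`. -/

open CategoryTheory.Subobject

namespace CategoryTheory

namespace Comma

/-! ### Componentwise limits in comma categories -/

section Limits

variable {J : Type u} [Category.{v} J] {A : Type*} [Category* A] {B : Type*} [Category* B]
  {T : Type*} [Category* T] (L : A ⥤ T) (R : B ⥤ T)

/-- The explicit limit cone of a comma category projects definitionally to the chosen limit cone of
the component. -/
instance preservesLimitsOfShape_fst [HasLimitsOfShape J A] [HasLimitsOfShape J B]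
    [PreservesLimitsOfShape J R] : PreservesLimitsOfShape J (Comma.fst L R) where
  preservesLimit :=
    preservesLimit_of_preserves_limit_cone
      (coneOfPreservesIsLimit _ (limit.isLimit _) (limit.isLimit _)) (limit.isLimit _)

instance preservesLimitsOfShape_snd [HasLimitsOfShape J A] [HasLimitsOfShape J B]
    [PreservesLimitsOfShape J R] : PreservesLimitsOfShape J (Comma.snd L R) where
  preservesLimit :=
    preservesLimit_of_preserves_limit_cone
      (coneOfPreservesIsLimit _ (limit.isLimit _) (limit.isLimit _)) (limit.isLimit _)

instance preservesFiniteLimits_fst [HasFiniteLimits A] [HasFiniteLimits B]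
    [PreservesFiniteLimits R] : PreservesFiniteLimits (Comma.fst L R) where
  preservesFiniteLimits _ := inferInstance

instance preservesFiniteLimits_snd [HasFiniteLimits A] [HasFiniteLimits B]
    [PreservesFiniteLimits R] : PreservesFiniteLimits (Comma.snd L R) where
  preservesFiniteLimits _ := inferInstance

variable {L R}

/-- A square in a comma category is a pullback if both of its components are, provided that
the right-hand functor preserves the relevant pullback. -/
lemma isPullback_of_left_right {P Q S W : Comma L R} {f : P ⟶ Q} {g : P ⟶ S} {h : Q ⟶ W}
    {k : S ⟶ W} (hl : IsPullback f.left g.left h.left k.left)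
    (hr : IsPullback f.right g.right h.right k.right)
    (hR : IsPullback (R.map f.right) (R.map g.right) (R.map h.right) (R.map k.right)) :
    IsPullback f g h k where
  w := by
    ext
    · exact hl.w
    · exact hr.w
  isLimit' := ⟨PullbackCone.IsLimit.mk _
    (fun s =>
      { left := hl.lift s.fst.left s.snd.left congr(($s.condition).left)
        right := hr.lift s.fst.right s.snd.right congr(($s.condition).right)
        w := by
          -- Compatibility of the two lifts is an equation of maps into the image under `R` of a
          -- pullback, so it is tested on the projections.
          apply hR.hom_ext
          · rw [assoc, assoc, ← R.map_comp, hr.lift_fst, ← f.w, ← L.map_comp_assoc, hl.lift_fst,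
              s.fst.w]
          · rw [assoc, assoc, ← R.map_comp, hr.lift_snd, ← g.w, ← L.map_comp_assoc, hl.lift_snd,
              s.snd.w] })
    (fun s => by ext <;> simp)
    (fun s => by ext <;> simp)
    (fun s m h₁ h₂ => by
      ext
      · apply hl.hom_ext <;> simp [← h₁, ← h₂]
      · apply hr.hom_ext <;> simp [← h₁, ← h₂])⟩

end Limits

end Comma

/-! ### Conjunction of truth values -/

namespace Subobject.Classifier

open CartesianMonoidalCategory MonoidalCategory

variable {C : Type u} [Category.{v} C] [CartesianMonoidalCategory C] (𝒞 : Classifier C)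

/-- The binary meet on the object of truth values. -/
def meet : 𝒞.Ω ⊗ 𝒞.Ω ⟶ 𝒞.Ω :=
  𝒞.χ (lift 𝒞.truth 𝒞.truth)

lemma lift_truth_truth_comp_meet :
    lift 𝒞.truth 𝒞.truth ≫ 𝒞.meet = 𝒞.truth := by
  rw [meet, (𝒞.isPullback (lift 𝒞.truth 𝒞.truth)).w, Subsingleton.elim (𝒞.χ₀ 𝒞.Ω₀) (𝟙 _), id_comp]

/-- The subobject classified by `f` is contained in the one classified by `g` if and only if the
meet of `f` and `g` is `f`. -/
lemma lift_comp_meet_eq_iff {U Y : C} {m : U ⟶ Y} {s : U ⟶ 𝒞.Ω₀} {f g : Y ⟶ 𝒞.Ω}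
    (h : IsPullback m s f 𝒞.truth) :
    lift f g ≫ 𝒞.meet = f ↔ m ≫ g = s ≫ 𝒞.truth := by
  have : Mono m := h.mono_fst_of_mono
  constructor
  · intro hfg
    have hm : (m ≫ lift f g) ≫ 𝒞.χ (lift 𝒞.truth 𝒞.truth) = s ≫ 𝒞.truth := by
      rw [assoc]
      exact (m ≫= hfg).trans h.w
    -- Where the meet is true, the pair factors through `(true, true)`; its second coordinate gives
    -- the claim.
    have := (𝒞.isPullback (lift 𝒞.truth 𝒞.truth)).lift_fst _ _ hm
    rw [Subsingleton.elim (IsPullback.lift _ _ _ _) s] at this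
    simpa using (this =≫ snd _ _).symm
  · intro hg
    -- As `g` is already true on `m`, the locus where both are true is `m`; so the meet also
    -- classifies `m`.
    have hsq : IsPullback m s (lift f g) (lift 𝒞.truth 𝒞.truth) := by
      refine IsPullback.mk' ?_ (fun T φ φ' h₁ _ => (cancel_mono m).1 h₁) fun T a b hab => ?_
      · ext <;> simp [h.w, hg]
      · have hf : a ≫ f = b ≫ 𝒞.truth := by simpa using hab =≫ fst _ _
        exact ⟨h.lift a b hf, by simp, by simp⟩
    exact (𝒞.uniq m (hsq.paste_vert (𝒞.isPullback _))).trans (𝒞.uniq m h).symm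

end Subobject.Classifier

end CategoryTheory

namespace CategoryTheory.Subobject.Classifier

open CartesianMonoidalCategory MonoidalCategory

/-! ### The subobject classifier of an Artin gluing -/

section Gluing

variable {C : Type u₁} [Category.{v₁} C] [CartesianMonoidalCategory C] [HasFiniteLimits C]
  {D : Type u₂} [Category.{v₂} D]
  (𝒞 : Classifier C) (𝒟 : Classifier D) (G : D ⥤ C) [PreservesFiniteLimits G]

/-- The comparison of truth values induced by a left exact functor. -/
def comparison : G.obj 𝒟.Ω ⟶ 𝒞.Ω :=
  𝒞.χ (G.map 𝒟.truth)

omit [CartesianMonoidalCategory C] [HasFiniteLimits C] in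
lemma map_truth_comp_comparison :
    G.map 𝒟.truth ≫ 𝒞.comparison 𝒟 G = 𝒞.χ₀ _ ≫ 𝒞.truth :=
  (𝒞.isPullback _).w

/-- The image under a left exact functor of the domain of the truth morphism is terminal. -/
noncomputable def isTerminalMapΩ₀ : IsTerminal (G.obj 𝒟.Ω₀) :=
  IsTerminal.isTerminalObj G _ 𝒟.isTerminalΩ₀

/-- Pairs of truth values `(p, q)` such that `p` implies the image of `q`. -/
noncomputable def glueΩLeft : C :=
  equalizer (fst 𝒞.Ω (G.obj 𝒟.Ω)) (lift (fst _ _) (snd _ _ ≫ 𝒞.comparison 𝒟 G) ≫ 𝒞.meet)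

/-- The inclusion of `glueΩLeft` in the product of the objects of truth values. -/
noncomputable def glueι : 𝒞.glueΩLeft 𝒟 G ⟶ 𝒞.Ω ⊗ G.obj 𝒟.Ω :=
  equalizer.ι _ _

/-- The first component of a pair of truth values. -/
noncomputable def glueFst : 𝒞.glueΩLeft 𝒟 G ⟶ 𝒞.Ω :=
  𝒞.glueι 𝒟 G ≫ fst _ _

/-- The second component of a pair of truth values. -/
noncomputable def glueSnd : 𝒞.glueΩLeft 𝒟 G ⟶ G.obj 𝒟.Ω :=
  𝒞.glueι 𝒟 G ≫ snd _ _

lemma glue_condition :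
    lift (𝒞.glueFst 𝒟 G) (𝒞.glueSnd 𝒟 G ≫ 𝒞.comparison 𝒟 G) ≫ 𝒞.meet = 𝒞.glueFst 𝒟 G := by
  have : 𝒞.glueι 𝒟 G ≫ fst _ _ =
      𝒞.glueι 𝒟 G ≫ lift (fst _ _) (snd _ _ ≫ 𝒞.comparison 𝒟 G) ≫ 𝒞.meet :=
    equalizer.condition _ _
  rw [comp_lift_assoc] at this
  simpa only [glueFst, glueSnd, assoc] using this.symm

variable {𝒞 𝒟 G} in
lemma glue_hom_ext {Y : C} {f g : Y ⟶ 𝒞.glueΩLeft 𝒟 G}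
    (h₁ : f ≫ 𝒞.glueFst 𝒟 G = g ≫ 𝒞.glueFst 𝒟 G)
    (h₂ : f ≫ 𝒞.glueSnd 𝒟 G = g ≫ 𝒞.glueSnd 𝒟 G) : f = g := by
  refine equalizer.hom_ext (show f ≫ 𝒞.glueι 𝒟 G = g ≫ 𝒞.glueι 𝒟 G from ?_)
  ext
  · simpa [glueFst] using h₁
  · simpa [glueSnd] using h₂

variable {𝒞 𝒟 G} in
/-- The universal property of `glueΩLeft`. -/
noncomputable def glueLift {Y : C} (f : Y ⟶ 𝒞.Ω) (g : Y ⟶ G.obj 𝒟.Ω)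
    (h : lift f (g ≫ 𝒞.comparison 𝒟 G) ≫ 𝒞.meet = f) : Y ⟶ 𝒞.glueΩLeft 𝒟 G :=
  equalizer.lift (lift f g) (by rw [comp_lift_assoc]; simp [h])

section

variable {Y : C} (f : Y ⟶ 𝒞.Ω) (g : Y ⟶ G.obj 𝒟.Ω)
  (h : lift f (g ≫ 𝒞.comparison 𝒟 G) ≫ 𝒞.meet = f)

lemma glueLift_fst : glueLift f g h ≫ 𝒞.glueFst 𝒟 G = f := by
  have : glueLift f g h ≫ 𝒞.glueι 𝒟 G = lift f g := equalizer.lift_ι _ _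
  rw [glueFst, reassoc_of% this, lift_fst]

lemma glueLift_snd : glueLift f g h ≫ 𝒞.glueSnd 𝒟 G = g := by
  have : glueLift f g h ≫ 𝒞.glueι 𝒟 G = lift f g := equalizer.lift_ι _ _
  rw [glueSnd, reassoc_of% this, lift_snd]

end

/-- A pair of truth values whose first component is true is true. -/
lemma isPullback_glue {t : 𝒞.Ω₀ ⟶ 𝒞.glueΩLeft 𝒟 G} (ht₁ : t ≫ 𝒞.glueFst 𝒟 G = 𝒞.truth)
    (ht₂ : t ≫ 𝒞.glueSnd 𝒟 G = (isTerminalMapΩ₀ 𝒟 G).from _ ≫ G.map 𝒟.truth) :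
    IsPullback t (𝟙 _) (𝒞.glueFst 𝒟 G) 𝒞.truth := by
  refine IsPullback.mk' (by simp [ht₁]) (fun _ _ _ _ _ => Subsingleton.elim _ _)
    fun Y a b hab => ⟨b, ?_, by simp⟩
  -- The first component is true on all of `Y`, so it classifies `𝟙 Y` and the containment criterion
  -- makes the comparison of the second component true.
  have hb : IsPullback (𝟙 Y) b (a ≫ 𝒞.glueFst 𝒟 G) 𝒞.truth :=
    IsPullback.mk' (by simp [hab]) (fun _ _ _ h _ => by simpa using h)
      fun _ c _ _ => ⟨c, by simp, Subsingleton.elim _ _⟩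
  have hc : lift (a ≫ 𝒞.glueFst 𝒟 G) (a ≫ 𝒞.glueSnd 𝒟 G ≫ 𝒞.comparison 𝒟 G) ≫ 𝒞.meet =
      a ≫ 𝒞.glueFst 𝒟 G := by
    rw [← comp_lift_assoc, glue_condition]
  rw [𝒞.lift_comp_meet_eq_iff hb, id_comp, ← assoc] at hc
  have hl := (𝒞.isPullback (G.map 𝒟.truth)).lift_fst _ _ hc
  apply glue_hom_ext
  · rw [assoc, ht₁, hab]
  · rw [assoc, ht₂, ← hl, ← assoc]
    congr 1
    exact (isTerminalMapΩ₀ 𝒟 G).hom_ext _ _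

/-- The object of truth values of an Artin gluing. -/
noncomputable def glueΩ : Comma (𝟭 C) G where
  left := 𝒞.glueΩLeft 𝒟 G
  right := 𝒟.Ω
  hom := 𝒞.glueSnd 𝒟 G

/-- The domain of the truth morphism of an Artin gluing. -/
noncomputable def glueΩ₀ : Comma (𝟭 C) G where
  left := 𝒞.Ω₀
  right := 𝒟.Ω₀
  hom := (isTerminalMapΩ₀ 𝒟 G).from _

omit [HasFiniteLimits C] in
lemma glueTruth_aux :
    lift 𝒞.truth (((isTerminalMapΩ₀ 𝒟 G).from _ ≫ G.map 𝒟.truth) ≫ 𝒞.comparison 𝒟 G) ≫ 𝒞.meet =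
      𝒞.truth := by
  rw [assoc, map_truth_comp_comparison, ← assoc, Subsingleton.elim (_ ≫ 𝒞.χ₀ _) (𝟙 _), id_comp,
    lift_truth_truth_comp_meet]

/-- The truth morphism of an Artin gluing. -/
noncomputable def glueTruth : 𝒞.glueΩ₀ 𝒟 G ⟶ 𝒞.glueΩ 𝒟 G where
  left := glueLift 𝒞.truth _ (𝒞.glueTruth_aux 𝒟 G)
  right := 𝒟.truth
  w := 𝒞.glueLift_snd 𝒟 G _ _ (𝒞.glueTruth_aux 𝒟 G)

lemma glueTruth_left_fst : (𝒞.glueTruth 𝒟 G).left ≫ 𝒞.glueFst 𝒟 G = 𝒞.truth :=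
  𝒞.glueLift_fst 𝒟 G _ _ (𝒞.glueTruth_aux 𝒟 G)

lemma glueTruth_left_snd : (𝒞.glueTruth 𝒟 G).left ≫ 𝒞.glueSnd 𝒟 G =
    (isTerminalMapΩ₀ 𝒟 G).from 𝒞.Ω₀ ≫ G.map 𝒟.truth :=
  𝒞.glueLift_snd 𝒟 G _ _ (𝒞.glueTruth_aux 𝒟 G)

/-- Pasting with this square trades pullbacks of the glued truth for pullbacks of `𝒞.truth`, in both
existence and uniqueness. -/
lemma isPullback_glueTruth :
    IsPullback (𝒞.glueTruth 𝒟 G).left (𝟙 𝒞.Ω₀) (𝒞.glueFst 𝒟 G) 𝒞.truth :=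
  𝒞.isPullback_glue 𝒟 G (𝒞.glueTruth_left_fst 𝒟 G) (𝒞.glueTruth_left_snd 𝒟 G)

variable [HasFiniteLimits D] {G} {U Y : Comma (𝟭 C) G} (m : U ⟶ Y)

omit [CartesianMonoidalCategory C] in
instance mono_left_of_mono [Mono m] : Mono m.left :=
  inferInstanceAs (Mono ((Comma.fst _ _).map m))

omit [CartesianMonoidalCategory C] in
instance mono_right_of_mono [Mono m] : Mono m.right :=
  inferInstanceAs (Mono ((Comma.snd _ _).map m))

omit [CartesianMonoidalCategory C] in
lemma comp_hom_comp_map_χ [Mono m] :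
    m.left ≫ Y.hom ≫ G.map (𝒟.χ m.right) = (isTerminalMapΩ₀ 𝒟 G).from _ ≫ G.map 𝒟.truth := by
  have hw : m.left ≫ Y.hom = U.hom ≫ G.map m.right := m.w
  rw [reassoc_of% hw, ← G.map_comp, (𝒟.isPullback m.right).w, G.map_comp, ← assoc]
  congr 1
  exact (isTerminalMapΩ₀ 𝒟 G).hom_ext _ _

/-- By `lift_comp_meet_eq_iff` this is a containment: `m.left` lies in the preimage under `Y.hom` of
`G.map m.right`, as witnessed by `U.hom`. -/
lemma glueχ_aux [Mono m] :
    lift (𝒞.χ m.left) ((Y.hom ≫ G.map (𝒟.χ m.right)) ≫ 𝒞.comparison 𝒟 G) ≫ 𝒞.meet =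
      𝒞.χ m.left := by
  rw [𝒞.lift_comp_meet_eq_iff (𝒞.isPullback m.left), ← assoc, comp_hom_comp_map_χ, assoc,
    map_truth_comp_comparison, ← assoc]
  congr 1
  exact Subsingleton.elim _ _

/-- The characteristic morphism of a monomorphism in an Artin gluing. -/
noncomputable def glueχ [Mono m] : Y ⟶ 𝒞.glueΩ 𝒟 G where
  left := glueLift _ _ (𝒞.glueχ_aux 𝒟 m)
  right := 𝒟.χ m.right
  w := 𝒞.glueLift_snd 𝒟 G _ _ (𝒞.glueχ_aux 𝒟 m)

/-- The morphism to the domain of the truth morphism of an Artin gluing. -/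
noncomputable def glueχ₀ (U : Comma (𝟭 C) G) : U ⟶ 𝒞.glueΩ₀ 𝒟 G where
  left := 𝒞.χ₀ _
  right := 𝒟.χ₀ _
  w := (isTerminalMapΩ₀ 𝒟 G).hom_ext _ _

lemma glueχ_left_fst [Mono m] : (𝒞.glueχ 𝒟 m).left ≫ 𝒞.glueFst 𝒟 G = 𝒞.χ m.left :=
  𝒞.glueLift_fst 𝒟 G _ _ (𝒞.glueχ_aux 𝒟 m)

lemma glueχ_left_snd [Mono m] :
    (𝒞.glueχ 𝒟 m).left ≫ 𝒞.glueSnd 𝒟 G = Y.hom ≫ G.map (𝒟.χ m.right) :=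
  𝒞.glueLift_snd 𝒟 G _ _ (𝒞.glueχ_aux 𝒟 m)

lemma isPullback_glueχ_left [Mono m] :
    IsPullback m.left (𝒞.χ₀ U.left) (𝒞.glueχ 𝒟 m).left (𝒞.glueTruth 𝒟 G).left := by
  refine IsPullback.of_bot ?_ ?_ (𝒞.isPullback_glueTruth 𝒟 G)
  · rw [comp_id, glueχ_left_fst]
    exact 𝒞.isPullback m.left
  · apply glue_hom_ext
    · exact (assoc _ _ _).trans <| (m.left ≫= 𝒞.glueχ_left_fst 𝒟 m).trans <|
        (𝒞.isPullback m.left).w.trans <| (𝒞.χ₀ _ ≫= (𝒞.glueTruth_left_fst 𝒟 G).symm).trans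
        (assoc _ _ _).symm
    · refine (assoc _ _ _).trans <| (m.left ≫= 𝒞.glueχ_left_snd 𝒟 m).trans <|
        (𝒟.comp_hom_comp_map_χ m).trans <| .trans ?_ <|
        (𝒞.χ₀ _ ≫= (𝒞.glueTruth_left_snd 𝒟 G).symm).trans (assoc _ _ _).symm
      rw [← assoc]
      congr 1
      exact (isTerminalMapΩ₀ 𝒟 G).hom_ext _ _

lemma isPullback_glueχ [Mono m] :
    IsPullback m (𝒞.glueχ₀ 𝒟 U) (𝒞.glueχ 𝒟 m) (𝒞.glueTruth 𝒟 G) :=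
  Comma.isPullback_of_left_right (𝒞.isPullback_glueχ_left 𝒟 m) (𝒟.isPullback m.right)
    ((𝒟.isPullback m.right).map G)

/-- The projections preserve pullbacks, so the right component and the first left coordinate are
characteristic maps; the other left coordinate is forced by `χ'.w`. -/
lemma glueχ_unique [Mono m] {χ₀' : U ⟶ 𝒞.glueΩ₀ 𝒟 G} {χ' : Y ⟶ 𝒞.glueΩ 𝒟 G}
    (h : IsPullback m χ₀' χ' (𝒞.glueTruth 𝒟 G)) : χ' = 𝒞.glueχ 𝒟 m := by
  have hr : χ'.right = 𝒟.χ m.right := 𝒟.uniq m.right (h.map (Comma.snd _ _))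
  have hl : IsPullback m.left χ₀'.left χ'.left (𝒞.glueTruth 𝒟 G).left := h.map (Comma.fst _ _)
  ext
  · apply glue_hom_ext
    · exact (𝒞.uniq m.left (hl.paste_vert (𝒞.isPullback_glueTruth 𝒟 G))).trans
        (𝒞.glueχ_left_fst 𝒟 m).symm
    · exact χ'.w.trans <| (congrArg (fun k => Y.hom ≫ G.map k) hr).trans
        (𝒞.glueχ_left_snd 𝒟 m).symm
  · exact hr

variable (G) in
/-- The subobject classifier of the Artin gluing of a left exact functor. -/
noncomputable def glue : Classifier (Comma (𝟭 C) G) where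
  Ω₀ := 𝒞.glueΩ₀ 𝒟 G
  Ω := 𝒞.glueΩ 𝒟 G
  truth := 𝒞.glueTruth 𝒟 G
  mono_truth := ⟨fun f g _ => by
    ext
    · exact Subsingleton.elim (α := _ ⟶ 𝒞.Ω₀) _ _
    · exact Subsingleton.elim (α := _ ⟶ 𝒟.Ω₀) _ _⟩
  χ₀ := 𝒞.glueχ₀ 𝒟
  χ m _ := 𝒞.glueχ 𝒟 m
  isPullback m _ := 𝒞.isPullback_glueχ 𝒟 m
  uniq m _ _ _ h := 𝒞.glueχ_unique 𝒟 m h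

end Gluing

end CategoryTheory.Subobject.Classifier

namespace CategoryTheory

namespace Comma

open CartesianMonoidalCategory MonoidalCategory MonoidalClosed Functor.LaxMonoidal

/-! ### Exponentials in an Artin gluing -/

lemma lift_fst_snd_comp {C : Type u} [Category.{v} C] [CartesianMonoidalCategory C] {a b c : C}
    (f : b ⟶ c) : lift (SemiCartesianMonoidalCategory.fst a b)
      (SemiCartesianMonoidalCategory.snd a b ≫ f) = a ◁ f := by
  apply CartesianMonoidalCategory.hom_ext <;> simp

section Tensor

variable {C : Type u₁} [Category.{v₁} C] [CartesianMonoidalCategory C]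
  {D : Type u₂} [Category.{v₂} D] [CartesianMonoidalCategory D]
  {G : D ⥤ C} [G.Monoidal]

/-- The componentwise product of two objects of an Artin gluing. -/
def tensor (P Q : Comma (𝟭 C) G) : Comma (𝟭 C) G where
  left := P.left ⊗ Q.left
  right := P.right ⊗ Q.right
  hom := (P.hom ⊗ₘ Q.hom) ≫ μ G P.right Q.right

/-- The first projection from the componentwise product. -/
def tensorFst (P Q : Comma (𝟭 C) G) : P.tensor Q ⟶ P where
  left := SemiCartesianMonoidalCategory.fst _ _
  right := SemiCartesianMonoidalCategory.fst _ _
  w := by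
    change SemiCartesianMonoidalCategory.fst _ _ ≫ P.hom = ((P.hom ⊗ₘ Q.hom) ≫ μ G _ _) ≫ G.map _
    rw [Category.assoc, Functor.Monoidal.μ_fst, tensorHom_fst]

/-- The second projection from the componentwise product. -/
def tensorSnd (P Q : Comma (𝟭 C) G) : P.tensor Q ⟶ Q where
  left := SemiCartesianMonoidalCategory.snd _ _
  right := SemiCartesianMonoidalCategory.snd _ _
  w := by
    change SemiCartesianMonoidalCategory.snd _ _ ≫ Q.hom = ((P.hom ⊗ₘ Q.hom) ≫ μ G _ _) ≫ G.map _
    rw [Category.assoc, Functor.Monoidal.μ_snd, tensorHom_snd]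

/-- The universal property of the componentwise product. -/
def tensorLift {P Q T : Comma (𝟭 C) G} (f : T ⟶ P) (g : T ⟶ Q) : T ⟶ P.tensor Q where
  left := lift f.left g.left
  right := lift f.right g.right
  w := by
    have hf : f.left ≫ P.hom = T.hom ≫ G.map f.right := f.w
    have hg : g.left ≫ Q.hom = T.hom ≫ G.map g.right := g.w
    change lift f.left g.left ≫ (P.hom ⊗ₘ Q.hom) ≫ μ G P.right Q.right = _
    rw [lift_map_assoc, hf, hg, ← comp_lift_assoc, Functor.Monoidal.lift_μ]
    rfl

/-- The componentwise product is a product. -/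
def isLimitTensor (P Q : Comma (𝟭 C) G) : IsLimit (BinaryFan.mk (tensorFst P Q) (tensorSnd P Q)) :=
  BinaryFan.IsLimit.mk _ tensorLift
    (fun _ _ => Comma.hom_ext _ _ (lift_fst _ _) (lift_fst _ _))
    (fun _ _ => Comma.hom_ext _ _ (lift_snd _ _) (lift_snd _ _))
    (fun f g m hf hg => by
      subst hf hg
      exact Comma.hom_ext _ _ (lift_comp_fst_snd (Y := P.left) (Z := Q.left) m.left).symm
        (lift_comp_fst_snd (Y := P.right) (Z := Q.right) m.right).symm)

variable (G) in
/-- The componentwise terminal object of an Artin gluing. -/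
def tensorUnit : Comma (𝟭 C) G where
  left := 𝟙_ C
  right := 𝟙_ D
  hom := ε G

variable (G) in
/-- The componentwise terminal object is terminal. -/
def isTerminalTensorUnit : IsTerminal (tensorUnit G) :=
  IsTerminal.ofUniqueHom
    (fun _ =>
      { left := toUnit _
        right := toUnit _
        w := (IsTerminal.isTerminalObj G _
          SemiCartesianMonoidalCategory.isTerminalTensorUnit).hom_ext _ _ })
    (fun _ _ => Comma.hom_ext _ _ (toUnit_unique _ _) (toUnit_unique _ _))

/-- The componentwise cartesian structure on an Artin gluing. -/
abbrev cartesianMonoidalCategory : CartesianMonoidalCategory (Comma (𝟭 C) G) :=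
  .ofChosenFiniteProducts ⟨_, isTerminalTensorUnit G⟩ fun P Q => ⟨_, isLimitTensor P Q⟩

end Tensor

section Closed

variable {C : Type u₁} [Category.{v₁} C] [CartesianMonoidalCategory C] [MonoidalClosed C]
  {D : Type u₂} [Category.{v₂} D] [CartesianMonoidalCategory D] [MonoidalClosed D]
  {G : D ⥤ C} [G.Monoidal]

section

variable {a b c : C} {x y z : D} (α : a ⟶ G.obj x) (β : b ⟶ G.obj y) (γ : c ⟶ G.obj z)

variable (y) in
/-- The comparison of exponentials induced by a product-preserving functor, restricted along
a morphism `a ⟶ G.obj x`. -/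
def expComparison : G.obj ((ihom x).obj y) ⟶ (ihom a).obj (G.obj y) :=
  curry (α ▷ _ ≫ μ G _ _ ≫ G.map ((ihom.ev x).app y))

lemma comp_map_comp_expComparison (g : z ⟶ (ihom x).obj y) :
    γ ≫ G.map g ≫ expComparison y α = curry (((α ⊗ₘ γ) ≫ μ G x z) ≫ G.map (uncurry g)) := by
  rw [expComparison, ← curry_natural_left, ← curry_natural_left]
  congr 1
  rw [tensorHom_def', Category.assoc, Category.assoc, whisker_exchange_assoc,
    μ_natural_right_assoc, uncurry_eq, G.map_comp]

/-- The two equations are transposes of each other. This matches the pullback condition for maps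
into the exponential with the comma square for maps out of the product. -/
lemma comp_ihom_map_eq_iff (u : c ⟶ (ihom a).obj b) (g : z ⟶ (ihom x).obj y) :
    u ≫ (ihom a).map β = (γ ≫ G.map g) ≫ expComparison y α ↔
      uncurry u ≫ β = ((α ⊗ₘ γ) ≫ μ G x z) ≫ G.map (uncurry g) := by
  rw [Category.assoc, comp_map_comp_expComparison, ← uncurry_natural_right,
    ← curry_injective.eq_iff (f := curry), curry_uncurry]

variable [HasPullbacks C]

/-- The `C`-component of the exponential in an Artin gluing. -/
noncomputable def expLeft : C :=
  pullback ((ihom a).map β) (expComparison y α)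

/-- The projection from `expLeft` to the exponential in `C`. -/
noncomputable def expLeftFst : expLeft α β ⟶ (ihom a).obj b :=
  pullback.fst _ _

/-- The projection from `expLeft` to the image of the exponential in `D`. -/
noncomputable def expLeftSnd : expLeft α β ⟶ G.obj ((ihom x).obj y) :=
  pullback.snd _ _

lemma isPullback_expLeft : IsPullback (expLeftFst α β) (expLeftSnd α β) ((ihom a).map β)
    (expComparison y α) :=
  .of_hasPullback _ _

end

variable [HasPullbacks C]

/-- The exponential in an Artin gluing. -/
noncomputable def exp (P Y : Comma (𝟭 C) G) : Comma (𝟭 C) G where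
  left := expLeft P.hom Y.hom
  right := (ihom P.right).obj Y.right
  hom := expLeftSnd P.hom Y.hom

omit [HasPullbacks C] in
lemma curry_condition {P Q Y : Comma (𝟭 C) G} (φ : P.tensor Q ⟶ Y) :
    curry (A := P.left) (Y := Q.left) φ.left ≫ (ihom P.left).map Y.hom =
      (Q.hom ≫ G.map (curry (A := P.right) (Y := Q.right) φ.right)) ≫
        expComparison Y.right P.hom := by
  refine (comp_ihom_map_eq_iff P.hom Y.hom Q.hom _ _).2 ?_
  exact (congrArg (· ≫ Y.hom) (uncurry_curry _)).trans <| φ.w.trans <|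
    congrArg (fun k => (P.tensor Q).hom ≫ G.map k) (uncurry_curry _).symm

/-- Currying in an Artin gluing. -/
noncomputable def expCurry {P Q Y : Comma (𝟭 C) G} (φ : P.tensor Q ⟶ Y) : Q ⟶ P.exp Y where
  left := (isPullback_expLeft P.hom Y.hom).lift _ _ (curry_condition φ)
  right := curry φ.right
  w := (isPullback_expLeft P.hom Y.hom).lift_snd _ _ (curry_condition φ)

lemma expCurry_left_fst {P Q Y : Comma (𝟭 C) G} (φ : P.tensor Q ⟶ Y) :
    (expCurry φ).left ≫ expLeftFst P.hom Y.hom = curry φ.left :=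
  (isPullback_expLeft P.hom Y.hom).lift_fst _ _ (curry_condition φ)

/-- Uncurrying in an Artin gluing. -/
noncomputable def expUncurry {P Q Y : Comma (𝟭 C) G} (ψ : Q ⟶ P.exp Y) : P.tensor Q ⟶ Y where
  left := uncurry (ψ.left ≫ expLeftFst P.hom Y.hom)
  right := uncurry ψ.right
  w := by
    have hψ : ψ.left ≫ expLeftSnd P.hom Y.hom = Q.hom ≫ G.map ψ.right := ψ.w
    refine (comp_ihom_map_eq_iff P.hom Y.hom Q.hom (ψ.left ≫ expLeftFst P.hom Y.hom) ψ.right).1 ?_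
    exact (Category.assoc _ _ _).trans <| (ψ.left ≫= (isPullback_expLeft P.hom Y.hom).w).trans <|
      (Category.assoc _ _ _).symm.trans <| congrArg (· ≫ expComparison Y.right P.hom) hψ

/-- The second pullback projection of the left component is determined by the right component
through the comma square. -/
lemma exp_hom_ext {P Q Y : Comma (𝟭 C) G} {ψ ψ' : Q ⟶ P.exp Y}
    (hl : ψ.left ≫ expLeftFst P.hom Y.hom = ψ'.left ≫ expLeftFst P.hom Y.hom)
    (hr : ψ.right = ψ'.right) : ψ = ψ' :=
  Comma.hom_ext _ _ ((isPullback_expLeft P.hom Y.hom).hom_ext hl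
    (ψ.w.trans <| (congrArg (fun k => Q.hom ≫ G.map k) hr).trans ψ'.w.symm)) hr

/-- The currying bijection in an Artin gluing. -/
noncomputable def expEquiv (P Q Y : Comma (𝟭 C) G) : (P.tensor Q ⟶ Y) ≃ (Q ⟶ P.exp Y) where
  toFun := expCurry
  invFun := expUncurry
  left_inv _ := Comma.hom_ext _ _
    ((congrArg uncurry (expCurry_left_fst _)).trans (uncurry_curry _)) (uncurry_curry _)
  right_inv _ := exp_hom_ext ((expCurry_left_fst _).trans (curry_uncurry _)) (curry_uncurry _)

/-- Whiskering by an object of an Artin gluing, for the componentwise product. -/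
def tensorMap (P : Comma (𝟭 C) G) {Q Q' : Comma (𝟭 C) G} (f : Q ⟶ Q') :
    P.tensor Q ⟶ P.tensor Q' :=
  tensorLift (tensorFst P Q) (tensorSnd P Q ≫ f)

/-- Naturality in `Q`, which makes the bijections `expEquiv` an adjunction. -/
lemma expCurry_tensorMap_comp {P Q Q' Y : Comma (𝟭 C) G} (f : Q' ⟶ Q) (g : P.tensor Q ⟶ Y) :
    expCurry (tensorMap P f ≫ g) = f ≫ expCurry g := by
  have hl : (tensorMap P f).left = P.left ◁ f.left := lift_fst_snd_comp _
  have hr : (tensorMap P f).right = P.right ◁ f.right := lift_fst_snd_comp _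
  refine exp_hom_ext ?_ ?_
  · refine (expCurry_left_fst _).trans <| (congrArg (fun k => curry (k ≫ g.left)) hl).trans <|
      (curry_natural_left _ _).trans <| (f.left ≫= (expCurry_left_fst g).symm).trans
      (Category.assoc _ _ _).symm
  · exact (congrArg (fun k => curry (k ≫ g.right)) hr).trans (curry_natural_left _ _)

attribute [local instance] cartesianMonoidalCategory in
omit [MonoidalClosed C] [MonoidalClosed D] [HasPullbacks C] in
lemma whiskerLeft_eq_tensorMap (P : Comma (𝟭 C) G) {Q Q' : Comma (𝟭 C) G} (f : Q ⟶ Q') :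
    P ◁ f = tensorMap P f :=
  CartesianMonoidalCategory.hom_ext _ _
    ((whiskerLeft_fst P f).trans
      (Comma.hom_ext _ _ (lift_fst _ _) (lift_fst _ _)).symm)
    ((whiskerLeft_snd P f).trans
      (Comma.hom_ext _ _ (lift_snd _ _) (lift_snd _ _)).symm)

attribute [local instance] cartesianMonoidalCategory in
/-- The Artin gluing of cartesian closed categories along a product-preserving functor is
cartesian closed. -/
noncomputable abbrev monoidalClosed : MonoidalClosed (Comma (𝟭 C) G) where
  closed P :=
    { rightAdj := Adjunction.rightAdjointOfEquiv (F := tensorLeft P) (fun Q Y => expEquiv P Q Y)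
        (fun _ _ _ f g =>
          (congrArg (fun k => expCurry (k ≫ g)) (whiskerLeft_eq_tensorMap P f)).trans
            (expCurry_tensorMap_comp f g))
      adj := Adjunction.adjunctionOfEquivRight _ _ }

end Closed
end Comma
end CategoryTheory

/-! ### Stability of topoi under gluing and equivalence -/

namespace IsTopos

open CategoryTheory.Subobject

/-- The Artin gluing of two topoi along a left exact functor is a topos. -/
lemma comma {C : Type u₁} [Category.{v₁} C] [IsTopos C] {D : Type u₂} [Category.{v₂} D] [IsTopos D]
    (G : D ⥤ C) [PreservesFiniteLimits G] : IsTopos (Comma (𝟭 C) G) := by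
  have := hasFiniteLimits (T := C)
  have := hasFiniteLimits (T := D)
  obtain ⟨_, ⟨_⟩⟩ := cartesianClosed (T := C)
  obtain ⟨_, ⟨_⟩⟩ := cartesianClosed (T := D)
  obtain ⟨⟨𝒞⟩⟩ := hasSubobjectClassifier (T := C)
  obtain ⟨⟨𝒟⟩⟩ := hasSubobjectClassifier (T := D)
  -- Left exactness gives preservation of finite products, hence the `μ` and `ε` used by the
  -- exponentials.
  let _ : G.Monoidal := .ofChosenFiniteProducts G
  exact
    { hasFiniteLimits := inferInstance
      cartesianClosed := ⟨Comma.cartesianMonoidalCategory, ⟨Comma.monoidalClosed⟩⟩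
      hasSubobjectClassifier := ⟨⟨𝒞.glue 𝒟 G⟩⟩ }

/-- A category equivalent to a topos is a topos. -/
lemma of_equivalence {C : Type u₁} [Category.{v₁} C] [IsTopos C] {D : Type u₂} [Category.{v₂} D]
    (e : C ≌ D) : IsTopos D := by
  have := hasFiniteLimits (T := C)
  have hD : HasFiniteLimits D :=
    ⟨fun _ _ _ => Adjunction.hasLimitsOfShape_of_equivalence e.inverse⟩
  obtain ⟨_, ⟨_⟩⟩ := cartesianClosed (T := C)
  obtain ⟨⟨𝒞⟩⟩ := hasSubobjectClassifier (T := C)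
  let _ : CartesianMonoidalCategory D := .ofHasFiniteProducts
  exact
    { hasFiniteLimits := hD
      cartesianClosed := ⟨inferInstance, ⟨cartesianClosedOfEquiv e⟩⟩
      hasSubobjectClassifier := ⟨⟨𝒞.ofEquivalence e⟩⟩ }

end IsTopos

/-! ### Structured cospans as an iterated gluing -/

namespace StrCsp

variable {A : Type u₁} [Category.{v₁} A] {X : Type u₂} [Category.{v₂} X]
  {L : A ⥤ X} {R : X ⥤ A} (adj : L ⊣ R)

/-- The functor from structured cospans to the iterated comma category, given by transposing both
legs. -/
def toComma : StrCsp L ⥤ Comma (𝟭 A) (Comma.snd (𝟭 A) R ⋙ R) where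
  obj S :=
    { left := S.outputs
      right := { left := S.inputs, right := S.apex, hom := adj.homEquiv _ _ S.inl }
      hom := adj.homEquiv _ _ S.inr }
  map {S T} φ :=
    { left := φ.h
      right :=
        { left := φ.f
          right := φ.g
          w := (adj.homEquiv_naturality_left φ.f T.inl).symm.trans <|
            (congrArg _ φ.wl.symm).trans (adj.homEquiv_naturality_right S.inl φ.g) }
      w := (adj.homEquiv_naturality_left φ.h T.inr).symm.trans <|
        (congrArg _ φ.wr.symm).trans (adj.homEquiv_naturality_right S.inr φ.g) }

/-- The functor from the iterated comma category to structured cospans, given by transposing both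
legs. -/
def ofComma : Comma (𝟭 A) (Comma.snd (𝟭 A) R ⋙ R) ⥤ StrCsp L where
  obj P :=
    { inputs := P.right.left
      apex := P.right.right
      outputs := P.left
      inl := (adj.homEquiv _ _).symm P.right.hom
      inr := (adj.homEquiv _ _).symm P.hom }
  map {P Q} φ :=
    { f := φ.right.left
      g := φ.right.right
      h := φ.left
      wl := (adj.homEquiv_naturality_right_symm P.right.hom φ.right.right).symm.trans <|
        (congrArg _ φ.right.w.symm).trans (adj.homEquiv_naturality_left_symm _ _)
      wr := (adj.homEquiv_naturality_right_symm (X := P.left) P.hom φ.right.right).symm.trans <|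
        (congrArg _ φ.w.symm).trans (adj.homEquiv_naturality_left_symm _ _) }

/-- Lets identities serve as the counit, whose source has its legs transposed twice. -/
lemma comp_id_eq_map_id_comp {a : A} {x : X} {k l : L.obj a ⟶ x} (h : k = l) :
    k ≫ 𝟙 x = L.map (𝟙 a) ≫ l := by
  simp [h]

/-- Structured cospans form an iterated comma category. -/
def commaEquivalence : Comma (𝟭 A) (Comma.snd (𝟭 A) R ⋙ R) ≌ StrCsp L where
  functor := ofComma adj
  inverse := toComma adj
  unitIso := NatIso.ofComponents (fun P =>
    Comma.isoMk (Iso.refl _)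
      (Comma.isoMk (Iso.refl _) (Iso.refl _) <|
        (id_comp _).trans <| ((adj.homEquiv _ _).apply_symm_apply P.right.hom).trans <|
          ((P.right.hom ≫= R.map_id _).trans (comp_id _)).symm) <|
      (id_comp _).trans <| ((adj.homEquiv _ _).apply_symm_apply P.hom).trans <|
        ((P.hom ≫= R.map_id _).trans (comp_id _)).symm)
    fun _ => Comma.hom_ext _ _ ((comp_id _).trans (id_comp _).symm) <|
      Comma.hom_ext _ _ ((comp_id _).trans (id_comp _).symm) ((comp_id _).trans (id_comp _).symm)
  counitIso := NatIso.ofComponents (fun S =>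
    { hom :=
        { f := 𝟙 _
          g := 𝟙 _
          h := 𝟙 _
          wl := comp_id_eq_map_id_comp ((adj.homEquiv _ _).symm_apply_apply S.inl)
          wr := comp_id_eq_map_id_comp ((adj.homEquiv _ _).symm_apply_apply S.inr) }
      inv :=
        { f := 𝟙 _
          g := 𝟙 _
          h := 𝟙 _
          wl := comp_id_eq_map_id_comp ((adj.homEquiv _ _).symm_apply_apply S.inl).symm
          wr := comp_id_eq_map_id_comp ((adj.homEquiv _ _).symm_apply_apply S.inr).symm }
      hom_inv_id := Hom.ext (comp_id _) (comp_id _) (comp_id _)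
      inv_hom_id := Hom.ext (comp_id _) (comp_id _) (comp_id _) })
    fun _ => Hom.ext ((comp_id _).trans (id_comp _).symm) ((comp_id _).trans (id_comp _).symm)
      ((comp_id _).trans (id_comp _).symm)
  functor_unitIso_comp _ := Hom.ext (comp_id _) (comp_id _) (comp_id _)

end StrCsp

theorem mainTheorem2 {A : Type u₁} [Category.{v₁} A] [IsTopos A]
    {X : Type u₂} [Category.{v₂} X] [IsTopos X]
    {L : A ⥤ X} {R : X ⥤ A} (adj : L ⊣ R) :
    IsTopos (StrCsp L) := by
  have := IsTopos.hasFiniteLimits (T := A)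
  have := IsTopos.hasFiniteLimits (T := X)
  have : PreservesLimitsOfSize.{0, 0} R := adj.rightAdjoint_preservesLimits
  have : PreservesFiniteLimits R := PreservesLimitsOfSize.preservesFiniteLimits R
  -- The inner gluing carries the input leg, the outer one the output leg; `snd` is left exact
  -- because `R` is.
  have := IsTopos.comma R
  have := IsTopos.comma (Comma.snd (𝟭 A) R ⋙ R)
  exact IsTopos.of_equivalence (StrCsp.commaEquivalence adj)
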